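/- Let $k$ be a field, and let $K_0(\mathcal V)$ be the Grothendieck ring of varieties over $k$: it is generated by the isomorphism classes $[X]$ of separated $k$-schemes of finite type, with $[X]=[Z]+[X\smallsetminus Z]$ for $Z\subseteq X$ closed, $[X\times_k Y]=[X][Y]$ and $[\operatorname{Spec}k]=1$. Let $\mathbb T=[\mathbb G_m]\in K_0(\mathcal V)$ be the class of the multiplicative group. For a finite graph $\Gamma$ with $n$ edges, let $\Psi_\Gamma=\sum_T\prod_{e\notin E(T)}t_e$ be its Kirchhoff polynomial, where $T$ runs over the spanning forests of $\Gamma$ (the maximal acyclic subgraphs; the spanning trees if $\Gamma$ is connected), and let $\mathbb U(\Gamma)=[\mathbb A^n\smallsetminus\{\Psi_\Gamma=0\}]\in K_0(\mathcal V)$. For $m\ge 0$ let $\Lambda_m$ be the $m$-th lemon graph, a chain of $m$ triangles fanning out from a common vertex: the graph obtained from a path with $m+1$ vertices (and $m$ edges) by adding one further vertex and joining it to every vertex of the path. So $\Lambda_0$ is a single edge and $\Lambda_1$ is a triangle. **Theorem.** In the ring $K_0(\mathcal V)[[s]]$ of formal power series, $$\sum_{m\ge 0}\mathbb U(\Lambda_m)\,s^m=\frac{\mathbb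 T+1}{1-\mathbb T(\mathbb T+1)s-\mathbb T(\mathbb T+1)^2s^2}.$$ Equivalently, $\mathbb U(\Lambda_0)=\mathbb T+1$, $\mathbb U(\Lambda_1)=\mathbb T(\mathbb T+1)^2$, and $$\mathbb U(\Lambda_{m+2})=\mathbb T(\mathbb T+1)\,\mathbb U(\Lambda_{m+1})+\mathbb T(\mathbb T+1)^2\,\mathbb U(\Lambda_m)\qquad\text{for all } m\ge 0.$$ -/

import Mathlib

open CategoryTheory AlgebraicGeometry

universe u

/-- A variety over `k`: a scheme, separated and of finite type over `Spec k`. -/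
structure Variety (k : Type u) [Field k] where
  /-- the underlying scheme -/
  carrier : Scheme.{u}
  /-- the structure morphism -/
  str : carrier ⟶ Spec (.of k)
  separated : IsSeparated str
  locallyOfFiniteType : LocallyOfFiniteType str
  quasiCompact : QuasiCompact str

namespace Variety

attribute [instance] separated locallyOfFiniteType quasiCompact

variable {k : Type u} [Field k]

/-- `Spec k` as a variety over `k`. -/
noncomputable def point (k : Type u) [Field k] : Variety k where
  carrier := Spec (.of k)
  str := 𝟙 _
  separated := inferInstance
  locallyOfFiniteType := inferInstance
  quasiCompact := inferInstance

/-- The product `X ×ₖ Y`. -/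
noncomputable def prod (X Y : Variety k) : Variety k where
  carrier := Limits.pullback X.str Y.str
  str := Limits.pullback.fst X.str Y.str ≫ X.str
  separated := inferInstance
  locallyOfFiniteType := inferInstance
  quasiCompact := inferInstance

/-- `Spec A`, for a finitely generated commutative `k`-algebra `A`. -/
noncomputable def spec (k : Type u) [Field k] (A : Type u) [CommRing A] [Algebra k A]
    [Algebra.FiniteType k A] : Variety k where
  carrier := Spec (.of A)
  str := Spec.map (CommRingCat.ofHom (algebraMap k A))
  separated := inferInstance
  locallyOfFiniteType := by
    rw [HasRingHomProperty.Spec_iff (P := @LocallyOfFiniteType)]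
    exact RingHom.finiteType_algebraMap.mpr inferInstance
  quasiCompact := inferInstance

/-- The multiplicative group `𝔾ₘ = Spec k[t, t⁻¹]`. -/
noncomputable def multiplicativeGroup (k : Type u) [Field k] : Variety k :=
  spec k (LaurentPolynomial k)

/-- An open subscheme of a variety. -/
noncomputable def openSubvariety (X : Variety k) (U : X.carrier.Opens) : Variety k where
  carrier := U
  str := U.ι ≫ X.str
  separated := inferInstance
  locallyOfFiniteType := inferInstance
  quasiCompact := by
    have : IsLocallyNoetherian X.carrier := LocallyOfFiniteType.isLocallyNoetherian X.str
    infer_instance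

/-- The complement of the hypersurface `f = 0` in the affine space `Spec k[tᵢ : i ∈ σ]`,
as an open subscheme of the affine space. -/
noncomputable def hypersurfaceComplement {σ : Type} [Finite σ] (f : MvPolynomial σ k) :
    Variety k :=
  (spec k (MvPolynomial σ k)).openSubvariety (PrimeSpectrum.basicOpen f)

end Variety

/-- The elements of the free commutative ring on the varieties over `k` that are set to zero in
the Grothendieck ring: isomorphism, cutting out a closed subvariety, and product of varieties. -/
inductive GrothendieckRelator (k : Type u) [Field k] : FreeCommRing (Variety k) → Prop
  | iso (X Y : Variety k) (φ : X.carrier ≅ Y.carrier) (hφ : φ.hom ≫ Y.str = X.str) :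
      GrothendieckRelator k (.of X - .of Y)
  | scissor (X Z U : Variety k) (i : Z.carrier ⟶ X.carrier) (j : U.carrier ⟶ X.carrier)
      (hi : i ≫ X.str = Z.str) (hj : j ≫ X.str = U.str)
      (hZ : IsClosedImmersion i) (hU : IsOpenImmersion j)
      (hUZ : Set.range j = (Set.range i)ᶜ) :
      GrothendieckRelator k (.of X - (.of Z + .of U))
  | one : GrothendieckRelator k (.of (Variety.point k) - 1)
  | mul (X Y : Variety k) : GrothendieckRelator k (.of (X.prod Y) - .of X * .of Y)

/-- The Grothendieck ring `K₀(𝒱)` of varieties over `k`: the commutative ring generated by the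
varieties over `k`, with `[X] = [Y]` if `X ≅ Y`, with `[X] = [Z] + [X ∖ Z]` for `Z` closed in
`X`, with `[X ×ₖ Y] = [X] [Y]` and with `[Spec k] = 1`. -/
def GrothendieckRing (k : Type u) [Field k] : Type (u + 1) :=
  FreeCommRing (Variety k) ⧸ Ideal.span {r | GrothendieckRelator k r}

namespace GrothendieckRing

variable {k : Type u} [Field k]

noncomputable instance : CommRing (GrothendieckRing k) :=
  inferInstanceAs (CommRing (FreeCommRing (Variety k) ⧸ Ideal.span {r | GrothendieckRelator k r}))

/-- The class `[X]` of a variety. -/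
noncomputable def mk (X : Variety k) : GrothendieckRing k :=
  Ideal.Quotient.mk (Ideal.span {r | GrothendieckRelator k r}) (.of X)

/-- The class `𝕋 = [𝔾ₘ]`. -/
noncomputable def torus (k : Type u) [Field k] : GrothendieckRing k :=
  mk (Variety.multiplicativeGroup k)

end GrothendieckRing

namespace SimpleGraph

variable {V : Type}

/-- `T` is a spanning forest of `G`: a maximal acyclic subgraph on all the vertices of `G`
(a spanning tree if `G` is connected). -/
def IsSpanningForest (G T : SimpleGraph V) : Prop :=
  Maximal (fun H : SimpleGraph V => H ≤ G ∧ H.IsAcyclic) T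

open Classical in
/-- The Kirchhoff polynomial `∑ T, ∏ e ∉ T, tₑ` of `G`, over its spanning forests `T`, in one
variable for every edge of `G`. -/
noncomputable def kirchhoffPolynomial [Fintype V] (k : Type u) [Field k] (G : SimpleGraph V) :
    MvPolynomial G.edgeSet k :=
  ∑ T : SimpleGraph V with G.IsSpanningForest T,
    ∏ e ∈ Finset.univ.filter fun e : G.edgeSet => e.1 ∉ T.edgeSet, MvPolynomial.X e

/-- The motivic Feynman rule `𝕌(G)`: the class of the complement of the affine graph hypersurface
in the affine space with one coordinate for every edge of `G`. -/
noncomputable def motivicClass [Fintype V] (k : Type u) [Field k] (G : SimpleGraph V) :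
    GrothendieckRing k :=
  .mk (.hypersurfaceComplement (G.kirchhoffPolynomial k))

end SimpleGraph

/-- The lemon graph `Λₘ`: the chain of `m` triangles fanning out from the vertex `none`. It is the
path with vertices `some 0, …, some m`, with every vertex of the path joined to `none`; the
`i`-th triangle has the vertices `none`, `some i`, `some (i + 1)`, and it shares with the next
triangle the edge from `none` to `some (i + 1)`. -/
def lemonGraph (m : ℕ) : SimpleGraph (Option (Fin (m + 1))) where
  Adj
    | none, none => False
    | none, some _ => True
    | some _, none => True
    | some i, some j => (SimpleGraph.pathGraph (m + 1)).Adj i j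
  symm := ⟨by
    rintro (_ | i) (_ | j) h
    · exact h
    · trivial
    · trivial
    · exact h.symm⟩
  loopless := ⟨by
    rintro (_ | i) h
    · exact h
    · exact h.ne rfl⟩

notation "𝕋" => GrothendieckRing.torus

notation "𝕌" => SimpleGraph.motivicClass

/-! Write `[f ≠ 0]` for the class of a principal open subset. The scissor relation gives `[a X + b ≠
0] = 𝕋 [a ≠ 0] + (𝕋 + 1) [a = 0, b ≠ 0]` (`openClass_linear`): where `a` is invertible, `a X + b` is
itself a coordinate on the line, and where `a = 0` the variable `X` is free.

Let `Ψ = a X + b` be the Kirchhoff polynomial of a lemon graph, `X` being the variable of its last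
spoke. Attaching a triangle with path edge `Y` and spoke `Z` turns it into `Ψ Z + (Ψ Y + X b)`, as
one sees by sorting the spanning trees by which of the two new edges they contain (`sum_isFanTree`).
Linearity in `Z` yields the class `𝕋 (𝕋 + 1) [Ψ ≠ 0] + (𝕋 + 1)² [Ψ = 0, X b ≠ 0]`. On the last set
`a ≠ 0` and `X = -b / a`, so its class is `[a b ≠ 0]` (`openClass_mk_linear`).

After a triangle has been attached, the pair `(a, b)` has become `(Ψ, Ψ Y + X b)`. Where `Ψ ≠ 0`,
the second entry can replace `Y` as a coordinate, so `[a b ≠ 0]` is now `𝕋 [Ψ ≠ 0]`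
(`openClass_fanPair_succ`). This closes the recursion of order two. It starts with `a = 0`, so the
correction term is absent in the first step. -/

section FiniteType

variable {k : Type u} [Field k] {A : Type u} [CommRing A] [Algebra k A] [Algebra.FiniteType k A]

instance Localization.Away.finiteType_of_finiteType (f : A) :
    Algebra.FiniteType k (Localization.Away f) :=
  have : Algebra.FiniteType A (Localization.Away f) :=
    IsLocalization.finiteType_of_monoid_fg (Submonoid.powers f) _
  .trans (S := A) inferInstance inferInstance

instance Polynomial.finiteType_of_finiteType : Algebra.FiniteType k (Polynomial A) :=
  .trans (S := A) inferInstance inferInstance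

instance TensorProduct.finiteType_of_finiteType {B : Type u} [CommRing B] [Algebra k B]
    [Algebra.FiniteType k B] : Algebra.FiniteType k (TensorProduct k A B) :=
  .trans (S := A) inferInstance inferInstance

end FiniteType

/-! ### Classes of affine varieties and of their principal open subsets. -/

namespace GrothendieckRing

variable {k : Type u} [Field k]

lemma mk_sub_eq_zero {r : FreeCommRing (Variety k)} (h : GrothendieckRelator k r) :
    (Ideal.Quotient.mk (Ideal.span {r | GrothendieckRelator k r}) r) = 0 :=
  Ideal.Quotient.eq_zero_iff_mem.2 (Ideal.subset_span h)

lemma mk_eq_of_iso {X Y : Variety k} (φ : X.carrier ≅ Y.carrier) (hφ : φ.hom ≫ Y.str = X.str) :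
    mk X = mk Y := by
  have := mk_sub_eq_zero (.iso X Y φ hφ)
  rw [map_sub] at this
  exact sub_eq_zero.1 this

lemma mk_eq_add {X Z U : Variety k} (i : Z.carrier ⟶ X.carrier) (j : U.carrier ⟶ X.carrier)
    (hi : i ≫ X.str = Z.str) (hj : j ≫ X.str = U.str)
    (hZ : IsClosedImmersion i) (hU : IsOpenImmersion j)
    (hUZ : Set.range j = (Set.range i)ᶜ) : mk X = mk Z + mk U := by
  have := mk_sub_eq_zero (.scissor X Z U i j hi hj hZ hU hUZ)
  rw [map_sub, map_add] at this
  exact sub_eq_zero.1 this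

lemma mk_point : mk (Variety.point k) = 1 := by
  have := mk_sub_eq_zero (.one (k := k))
  rw [map_sub, map_one] at this
  exact sub_eq_zero.1 this

lemma mk_prod (X Y : Variety k) : mk (X.prod Y) = mk X * mk Y := by
  have := mk_sub_eq_zero (.mul X Y)
  rw [map_sub, map_mul] at this
  exact sub_eq_zero.1 this

/-- The class of `Spec A`. -/
noncomputable def affineClass (k : Type u) [Field k] (A : Type u) [CommRing A] [Algebra k A]
    [Algebra.FiniteType k A] : GrothendieckRing k :=
  mk (Variety.spec k A)

/-- The class of the principal open subset `f ≠ 0` of `Spec A`. -/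
noncomputable def openClass (k : Type u) [Field k] {A : Type u} [CommRing A] [Algebra k A]
    [Algebra.FiniteType k A] (f : A) : GrothendieckRing k :=
  affineClass k (Localization.Away f)

section

variable {A B : Type u} [CommRing A] [Algebra k A] [Algebra.FiniteType k A]
  [CommRing B] [Algebra k B] [Algebra.FiniteType k B]

lemma affineClass_congr (e : A ≃ₐ[k] B) : affineClass k A = affineClass k B := by
  refine (mk_eq_of_iso (X := .spec k B) (Y := .spec k A)
    (Scheme.Spec.mapIso e.toRingEquiv.toCommRingCatIso.op) ?_).symm
  simp only [Variety.spec, Functor.mapIso_hom, Iso.op_hom, Scheme.Spec_map, Quiver.Hom.unop_op,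
    RingEquiv.toCommRingCatIso_hom]
  rw [← Spec.map_comp, ← CommRingCat.ofHom_comp]
  congr 2
  ext x
  simp

lemma affineClass_self : affineClass k k = 1 := by
  rw [← mk_point]
  refine mk_eq_of_iso (X := .spec k k) (Y := .point k) (Iso.refl _) ?_
  simp only [Variety.spec, Variety.point, Algebra.algebraMap_self, CommRingCat.ofHom_id,
    Spec.map_id]
  rfl

lemma affineClass_tensorProduct :
    affineClass k (TensorProduct k A B) = affineClass k A * affineClass k B := by
  simp only [affineClass]
  rw [← mk_prod]
  refine (mk_eq_of_iso (X := (Variety.spec k A).prod (.spec k B))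
    (Y := .spec k (TensorProduct k A B)) (pullbackSpecIso k A B) ?_).symm
  simp only [Variety.spec, Variety.prod]
  rw [← pullbackSpecIso_hom_fst k A B, Category.assoc, ← Spec.map_comp, ← CommRingCat.ofHom_comp]

lemma affineClass_eq_add (f : A) :
    affineClass k A = affineClass k (A ⧸ Ideal.span {f}) + openClass k f := by
  refine mk_eq_add (X := .spec k A) (Z := .spec k (A ⧸ Ideal.span {f}))
    (U := .spec k (Localization.Away f))
    (Spec.map (CommRingCat.ofHom (Ideal.Quotient.mk (Ideal.span {f}))))
    (Spec.map (CommRingCat.ofHom (algebraMap A (Localization.Away f)))) ?_ ?_ ?_ ?_ ?_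
  · simp only [Variety.spec]
    rw [← Spec.map_comp, ← CommRingCat.ofHom_comp]
  · simp only [Variety.spec]
    rw [← Spec.map_comp, ← CommRingCat.ofHom_comp]
  · exact IsClosedImmersion.spec_of_quotient_mk (R := .of A) _
  · exact Scheme.isOpenImmersion_SpecMap_localizationAway (R := .of A) f
  · refine (PrimeSpectrum.localization_away_comap_range (Localization.Away f) f).trans ?_
    refine Eq.trans ?_ (congrArg _ (range_comap_of_surjective _
      (Ideal.Quotient.mk (Ideal.span {f})) Ideal.Quotient.mk_surjective).symm)
    rw [Ideal.mk_ker, PrimeSpectrum.zeroLocus_span, PrimeSpectrum.basicOpen_eq_zeroLocus_compl]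
    rfl

lemma openClass_eq_affineClass (f : A) [Algebra A B] [IsScalarTower k A B]
    [IsLocalization.Away f B] : openClass k f = affineClass k B :=
  affineClass_congr ((IsLocalization.algEquiv (Submonoid.powers f)
    (Localization.Away f) B).restrictScalars k)

lemma openClass_of_isUnit {f : A} (hf : IsUnit f) : openClass k f = affineClass k A :=
  have : IsLocalization.Away f A := IsLocalization.away_of_isUnit_of_bijective A hf
    Function.bijective_id
  openClass_eq_affineClass f

/-- The closed subscheme cut out by `0` is everything, so the scissor relation leaves nothing for
the open part. -/
lemma openClass_zero : openClass k (0 : A) = 0 := by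
  have h := affineClass_eq_add (k := k) (0 : A)
  have e : (A ⧸ Ideal.span {(0 : A)}) ≃ₐ[k] A :=
    (Ideal.quotientEquivAlgOfEq k (by simp)).trans (AlgEquiv.quotientBot k A)
  rw [affineClass_congr e] at h
  simpa using h

lemma openClass_congr (e : A ≃ₐ[k] B) (f : A) : openClass k f = openClass k (e f) :=
  affineClass_congr (IsLocalization.algEquivOfAlgEquiv (M := Submonoid.powers f)
    (T := Submonoid.powers (e f)) _ _ e (Submonoid.map_powers _ _))

/-- The class of the part of a localization where a further function does not vanish. -/
lemma openClass_algebraMap (a f : A) [Algebra A B] [IsScalarTower k A B]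
    [IsLocalization.Away a B] : openClass k (algebraMap A B f) = openClass k (a * f) := by
  have := IsLocalization.Away.mul' B (Localization.Away (algebraMap A B f)) a f
  exact (openClass_eq_affineClass (a * f)).symm

/-- The basic cut: the scissor relation for `a` on the open set `f ≠ 0`, using that localization
commutes with quotients. -/
lemma openClass_eq_add (f a : A) :
    openClass k f =
      openClass k (Ideal.Quotient.mk (Ideal.span {a}) f) + openClass k (a * f) := by
  rw [mul_comm, ← openClass_algebraMap (B := Localization.Away f), openClass,
    affineClass_eq_add (algebraMap A (Localization.Away f) a)]
  congr 1
  set I := Ideal.span {a} with hI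
  have : IsLocalization.Away (Ideal.Quotient.mk I f)
      (Localization.Away f ⧸ I.map (algebraMap A (Localization.Away f))) := by
    have := IsLocalization.of_surjective (Submonoid.powers f) (Localization.Away f)
      (Ideal.Quotient.mk I) Ideal.Quotient.mk_surjective
      (Ideal.Quotient.mk (I.map (algebraMap A (Localization.Away f))))
      Ideal.Quotient.mk_surjective rfl (by simp)
    rwa [Submonoid.map_powers] at this
  have : IsScalarTower k (A ⧸ I)
      (Localization.Away f ⧸ I.map (algebraMap A (Localization.Away f))) :=
    .of_algebraMap_eq fun x => by
      rw [← Ideal.Quotient.mk_algebraMap, ← Ideal.Quotient.mk_algebraMap,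
        IsScalarTower.algebraMap_apply k A (Localization.Away f)]
      rfl
  rw [openClass_eq_affineClass (Ideal.Quotient.mk I f)
    (B := Localization.Away f ⧸ I.map (algebraMap A (Localization.Away f)))]
  exact affineClass_congr (Ideal.quotientEquivAlgOfEq k (by simp [hI, Ideal.map_span]))

end

end GrothendieckRing

/-! ### Affine lines over a base, and polynomials linear in one variable. -/

namespace GrothendieckRing

variable {k : Type u} [Field k]

section

open Polynomial

variable {A : Type u} [CommRing A] [Algebra k A] [Algebra.FiniteType k A]

attribute [local instance] Polynomial.algebra Polynomial.isLocalization

lemma openClass_X_self : openClass k (X : k[X]) = 𝕋 k :=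
  have : IsScalarTower k k[X] (LaurentPolynomial k) := .of_algebraMap_eq fun x => by
    rw [LaurentPolynomial.algebraMap_eq_toLaurent, Polynomial.algebraMap_apply,
      Polynomial.toLaurent_C]
    rfl
  openClass_eq_affineClass (B := LaurentPolynomial k) X

lemma affineClass_polynomial_self : affineClass k k[X] = 𝕋 k + 1 := by
  rw [affineClass_eq_add (X : k[X]), openClass_X_self, add_comm]
  congr 1
  rw [← affineClass_self]
  exact affineClass_congr ((Ideal.quotientEquivAlgOfEq k (by simp)).trans
    (quotientSpanXSubCAlgEquiv (0 : k)))

lemma affineClass_polynomial : affineClass k A[X] = (𝕋 k + 1) * affineClass k A := by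
  rw [affineClass_congr (polyEquivTensor k A), affineClass_tensorProduct,
    affineClass_polynomial_self, mul_comm]

lemma openClass_X : openClass k (X : A[X]) = 𝕋 k * affineClass k A := by
  have h := affineClass_eq_add (k := k) (X : A[X])
  have e : (A[X] ⧸ Ideal.span {(X : A[X])}) ≃ₐ[k] A :=
    (Ideal.quotientEquivAlgOfEq k (by simp)).trans
      ((quotientSpanXSubCAlgEquiv (0 : A)).restrictScalars k)
  rw [affineClass_congr e, affineClass_polynomial] at h
  linear_combination -h

lemma openClass_mk_X (f : A[X]) :
    openClass k (Ideal.Quotient.mk (Ideal.span {X}) f) = openClass k (f.eval 0) := by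
  rw [openClass_congr ((Ideal.quotientEquivAlgOfEq k (by simp)).trans
    ((quotientSpanXSubCAlgEquiv (0 : A)).restrictScalars k))]
  rfl

/-- The substitution `X ↦ a X + b` is an automorphism of the line over the base. -/
lemma openClass_linear_of_isUnit {a : A} (ha : IsUnit a) (b : A) :
    openClass k (C a * X + C b) = 𝕋 k * affineClass k A := by
  let := ha.invertible
  rw [← openClass_X, openClass_congr ((algEquivCMulXAddC a b).restrictScalars k) X]
  simp

/-- The part of the affine line over the open set `a ≠ 0` where a further polynomial does not
vanish. -/
lemma openClass_C_mul (a : A) (f : A[X]) :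
    openClass k (C a * f) = openClass k (f.map (algebraMap A (Localization.Away a))) := by
  have : IsLocalization.Away (C a) (Localization.Away a)[X] := by
    have := Polynomial.isLocalization (Submonoid.powers a) (Localization.Away a)
    rwa [Submonoid.map_powers] at this
  have : IsScalarTower k A[X] (Localization.Away a)[X] := .of_algebraMap_eq fun x => by
    simp [Polynomial.algebraMap_apply, ← IsScalarTower.algebraMap_apply, RingHom.algebraMap_toAlgebra]
  rw [← openClass_algebraMap (B := (Localization.Away a)[X])]
  rfl

lemma openClass_C (a : A) : openClass k (C a) = (𝕋 k + 1) * openClass k a := by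
  have := openClass_C_mul (k := k) a 1
  rw [mul_one, Polynomial.map_one, openClass_of_isUnit isUnit_one, affineClass_polynomial] at this
  exact this

lemma openClass_C_mul_linear (a b : A) :
    openClass k (C a * (C a * X + C b)) = 𝕋 k * openClass k a := by
  rw [openClass_C_mul]
  simp only [Polynomial.map_add, Polynomial.map_mul, map_C, map_X]
  exact openClass_linear_of_isUnit (IsLocalization.Away.algebraMap_isUnit a) _

lemma openClass_mk_C (a : A) (f : A[X]) :
    openClass k (Ideal.Quotient.mk (Ideal.span {C a}) f) =
      openClass k (f.map (Ideal.Quotient.mk (Ideal.span {a}))) := by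
  let e : (A[X] ⧸ (Ideal.span {a}).map C) ≃ₐ[k] (A ⧸ Ideal.span {a})[X] :=
    AlgEquiv.ofRingEquiv (f := (Ideal.polynomialQuotientEquivQuotientPolynomial _).symm) fun x => by
      rw [← Ideal.Quotient.mk_algebraMap,
        Ideal.polynomialQuotientEquivQuotientPolynomial_symm_mk, Polynomial.algebraMap_apply, map_C]
      rfl
  rw [openClass_congr (Ideal.quotientEquivAlgOfEq k
    (show Ideal.span {C a} = (Ideal.span {a}).map C by simp [Ideal.map_span])),
    openClass_congr e]
  rfl

/-- The hypersurface complement of a polynomial that is linear in one of the variables. -/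
lemma openClass_linear (a b : A) :
    openClass k (C a * X + C b) =
      𝕋 k * openClass k a +
        (𝕋 k + 1) * openClass k (Ideal.Quotient.mk (Ideal.span {a}) b) := by
  -- Cut along `a = 0`; on the closed part the polynomial becomes the constant `b`.
  rw [openClass_eq_add _ (C a), openClass_C_mul_linear, openClass_mk_C]
  simp only [Polynomial.map_add, Polynomial.map_mul, map_C, map_X]
  rw [Ideal.Quotient.eq_zero_iff_mem.2 (Ideal.mem_span_singleton_self a), C_0, zero_mul, zero_add,
    openClass_C, add_comm]

lemma openClass_linear_congr {B : Type u} [CommRing B] [Algebra k B] [Algebra.FiniteType k B]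
    (e : A ≃ₐ[k] B) (a b : A) :
    openClass k (C a * X + C b) = openClass k (C (e a) * X + C (e b)) := by
  have hC (c : A) : mapAlgEquiv e (C c) = C (e c) := map_C _
  have hX : mapAlgEquiv e X = X := map_X _
  rw [openClass_congr (mapAlgEquiv e), map_add, map_mul, hC, hC, hX]

/-- The solutions of `a x + b = 0` with `x b ≠ 0` are parametrized by the pairs `(a, b)` with
`a b ≠ 0`. -/
lemma openClass_mk_linear (a b : A) :
    openClass k (Ideal.Quotient.mk (Ideal.span {C a * X + C b}) (X * C b)) =
      openClass k (a * b) := by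
  -- Instead of constructing the parametrization, the class is obtained by subtraction: cut `X b ≠
  -- 0` along `a X + b = 0`, and evaluate the open part by cutting `b (a X + b) ≠ 0` along `X = 0`.
  have hX : openClass k (X * C b) = 𝕋 k * openClass k b := by
    have := openClass_C_mul (k := k) b X
    rwa [map_X, openClass_X, mul_comm (C b)] at this
  have hbb : openClass k (b * b) = openClass k b := by
    rw [← openClass_algebraMap (B := Localization.Away b),
      openClass_of_isUnit (IsLocalization.Away.algebraMap_isUnit b)]
    rfl
  have hb : openClass k (C b * (C a * X + C b)) =
      (𝕋 k + 1) * openClass k b - openClass k (a * b) := by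
    have h := affineClass_eq_add (k := k) (algebraMap A (Localization.Away b) a)
    rw [openClass_algebraMap b a, ← openClass] at h
    rw [openClass_C_mul]
    simp only [Polynomial.map_add, Polynomial.map_mul, map_C, map_X]
    rw [openClass_linear, openClass_algebraMap b a, openClass_of_isUnit
      ((IsLocalization.Away.algebraMap_isUnit b).map (Ideal.Quotient.mk _)), h, mul_comm b a]
    ring
  have h₁ := openClass_eq_add (k := k) (X * C b) (C a * X + C b)
  have h₂ := openClass_eq_add (k := k) (C b * (C a * X + C b)) X
  rw [openClass_mk_X, hb] at h₂
  simp only [eval_mul, eval_add, eval_C, eval_X, mul_zero, zero_add, hbb] at h₂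
  rw [hX, show (C a * X + C b) * (X * C b) = X * (C b * (C a * X + C b)) by ring] at h₁
  linear_combination h₂ - h₁

/-- Two steps of the recursion for the fan. -/
lemma openClass_fan (a b : A) :
    openClass k (C (C (C a * X + C b)) * X + C (C (C a * X + C b) * X + C (X * C b)) : A[X][X][X]) =
      𝕋 k * (𝕋 k + 1) * openClass k (C a * X + C b) + (𝕋 k + 1) ^ 2 * openClass k (a * b) := by
  -- Modulo the leading coefficient, the middle variable drops out of the constant term; it is free
  -- on both pieces and gives each a factor `𝕋 + 1`.
  rw [openClass_linear, openClass_C, openClass_mk_C]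
  simp only [Polynomial.map_add, Polynomial.map_mul, map_C, map_X]
  rw [Ideal.Quotient.eq_zero_iff_mem.2 (Ideal.mem_span_singleton_self _), C_0, zero_mul, zero_add,
    openClass_C, openClass_mk_linear]
  ring

end

end GrothendieckRing

/-! ### The recursive form of the Kirchhoff polynomials. -/

section FanPolynomial

variable {S : Type*} [CommRing S]

/-- The coefficients `(a, b)` of the Kirchhoff polynomial `x₂ₘ a + b` of the `m`-th lemon graph, as
a polynomial in the variable of its last spoke. -/
def fanPair (x : ℕ → S) : ℕ → S × S
  | 0 => (0, 1)
  | m + 1 =>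
    (x (2 * m) * (fanPair x m).1 + (fanPair x m).2,
      x (2 * m + 1) * (x (2 * m) * (fanPair x m).1 + (fanPair x m).2) +
        x (2 * m) * (fanPair x m).2)

/-- The Kirchhoff polynomial of the `m`-th lemon graph; the variables of the spokes are the `x₂ᵢ`,
and those of the edges of the path are the `x₂ᵢ₊₁`. -/
def fanPolynomial (x : ℕ → S) (m : ℕ) : S :=
  x (2 * m) * (fanPair x m).1 + (fanPair x m).2

/-- Only the variables below `2 * m` occur, so the pair can be moved between polynomial rings in
different numbers of variables. -/
lemma map_fanPair {S' : Type*} [CommRing S'] (φ : S →+* S') {x : ℕ → S} {y : ℕ → S'} {m : ℕ}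
    (h : ∀ i < 2 * m, φ (x i) = y i) :
    φ (fanPair x m).1 = (fanPair y m).1 ∧ φ (fanPair x m).2 = (fanPair y m).2 := by
  induction m with
  | zero => simp [fanPair]
  | succ m ih =>
    obtain ⟨h₁, h₂⟩ := ih fun i hi => h i (by lia)
    simp only [fanPair, map_add, map_mul, h₁, h₂, h (2 * m) (by lia), h (2 * m + 1) (by lia),
      and_self]

end FanPolynomial

/-! ### Splitting off the last variables of a polynomial ring. -/

namespace MvPolynomial

variable (k : Type u) [Field k]

/-- The variables of `k[X₀, …, Xₙ₋₁]`, continued by zero. -/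
noncomputable def finVar (n i : ℕ) : MvPolynomial (Fin n) k :=
  if h : i < n then X ⟨i, h⟩ else 0

/-- Separating the last variable. -/
noncomputable def finLastEquiv (n : ℕ) :
    MvPolynomial (Fin (n + 1)) k ≃ₐ[k] Polynomial (MvPolynomial (Fin n) k) :=
  (renameEquiv k finSuccEquivLast).trans ((optionEquivLeft k (Fin n)))

variable {k}

lemma finLastEquiv_finVar {n i : ℕ} (h : i < n) :
    finLastEquiv k n (finVar k (n + 1) i) = Polynomial.C (finVar k n i) := by
  have : finSuccEquivLast (⟨i, h.trans n.lt_succ_self⟩ : Fin (n + 1)) = some ⟨i, h⟩ :=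
    finSuccEquivLast_castSucc ⟨i, h⟩
  simp [finLastEquiv, finVar, h, h.trans n.lt_succ_self, this]

lemma finLastEquiv_finVar_last (n : ℕ) :
    finLastEquiv k n (finVar k (n + 1) n) = Polynomial.X := by
  have : finSuccEquivLast (⟨n, n.lt_succ_self⟩ : Fin (n + 1)) = none :=
    finSuccEquivLast_last
  simp [finLastEquiv, finVar, this]

lemma exists_equiv_finVar (n : ℕ) :
    ∃ e : MvPolynomial (Fin (n + 1 + 1)) k ≃ₐ[k] Polynomial (Polynomial (MvPolynomial (Fin n) k)),
      (∀ i < n, e (finVar k (n + 1 + 1) i) = Polynomial.C (Polynomial.C (finVar k n i))) ∧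
      e (finVar k (n + 1 + 1) n) = Polynomial.C Polynomial.X ∧
      e (finVar k (n + 1 + 1) (n + 1)) = Polynomial.X := by
  have hC (c : MvPolynomial (Fin (n + 1)) k) :
      Polynomial.mapAlgEquiv (finLastEquiv k n) (Polynomial.C c) =
        Polynomial.C (finLastEquiv k n c) :=
    Polynomial.map_C _
  refine ⟨(finLastEquiv k (n + 1)).trans (Polynomial.mapAlgEquiv (finLastEquiv k n)),
    fun i hi => ?_, ?_, ?_⟩
  · rw [AlgEquiv.trans_apply, finLastEquiv_finVar (hi.trans n.lt_succ_self), hC,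
      finLastEquiv_finVar hi]
  · rw [AlgEquiv.trans_apply, finLastEquiv_finVar n.lt_succ_self, hC, finLastEquiv_finVar_last]
  · rw [AlgEquiv.trans_apply, finLastEquiv_finVar_last]
    exact Polynomial.map_X _

end MvPolynomial

/-! ### The recursion for the classes of the fan polynomials. -/

namespace GrothendieckRing

open MvPolynomial

variable {k : Type u} [Field k]

lemma affineClass_mvPolynomial_fin_zero : affineClass k (MvPolynomial (Fin 0) k) = 1 := by
  rw [affineClass_congr (isEmptyAlgEquiv k (Fin 0)), affineClass_self]

lemma affineClass_mvPolynomial_fin_one : affineClass k (MvPolynomial (Fin 1) k) = 𝕋 k + 1 := by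
  rw [affineClass_congr (finLastEquiv k 0), affineClass_polynomial,
    affineClass_mvPolynomial_fin_zero, mul_one]

lemma openClass_fanPolynomial (m : ℕ) :
    openClass k (fanPolynomial (finVar k (2 * m + 1)) m) =
      openClass k (Polynomial.C (fanPair (finVar k (2 * m)) m).1 * Polynomial.X +
        Polynomial.C (fanPair (finVar k (2 * m)) m).2) := by
  obtain ⟨h₁, h₂⟩ := map_fanPair
    (x := finVar k (2 * m + 1)) (y := fun i => Polynomial.C (finVar k (2 * m) i)) (m := m)
    (finLastEquiv k (2 * m) : _ →+* _) fun i hi => finLastEquiv_finVar hi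
  obtain ⟨h₃, h₄⟩ := map_fanPair
    (x := finVar k (2 * m)) (y := fun i => Polynomial.C (finVar k (2 * m) i)) (m := m)
    Polynomial.C fun i hi => rfl
  rw [RingHom.coe_coe] at h₁ h₂
  rw [openClass_congr (B := Polynomial (MvPolynomial (Fin (2 * m)) k)) (finLastEquiv k (2 * m)),
    h₃, h₄, fanPolynomial, map_add, map_mul, finLastEquiv_finVar_last, h₁, h₂,
    Polynomial.X_mul]

/-- Separating the last two variables in the coefficients of the fan polynomial. -/
lemma exists_equiv_fanPair_succ {n m : ℕ} (hn : n = 2 * m + 1 + 1) :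
    ∃ e : MvPolynomial (Fin n) k ≃ₐ[k] Polynomial (Polynomial (MvPolynomial (Fin (2 * m)) k)),
      letI a := (fanPair (finVar k (2 * m)) m).1
      letI b := (fanPair (finVar k (2 * m)) m).2
      letI f := Polynomial.C a * Polynomial.X + Polynomial.C b
      e (fanPair (finVar k n) (m + 1)).1 = Polynomial.C f ∧
      e (fanPair (finVar k n) (m + 1)).2 =
        Polynomial.C f * Polynomial.X + Polynomial.C (Polynomial.X * Polynomial.C b) := by
  -- A free `n` lets the lemma apply to `Fin (2 * (m + 1))`, while the splitting needs the form `2 *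
  -- m + 1 + 1`.
  subst hn
  obtain ⟨e, he, he₀, he₁⟩ := exists_equiv_finVar (k := k) (2 * m)
  obtain ⟨h₁, h₂⟩ := map_fanPair
    (x := finVar k (2 * m + 1 + 1)) (m := m)
    (y := fun i => Polynomial.C (Polynomial.C (finVar k (2 * m) i)))
    (e : _ →+* _) fun i hi => he i hi
  obtain ⟨h₃, h₄⟩ := map_fanPair
    (x := finVar k (2 * m)) (m := m)
    (y := fun i => Polynomial.C (Polynomial.C (finVar k (2 * m) i)))
    (Polynomial.C.comp Polynomial.C) fun i hi => rfl
  rw [← h₃, RingHom.coe_coe, RingHom.comp_apply] at h₁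
  rw [← h₄, RingHom.coe_coe, RingHom.comp_apply] at h₂
  have h : e (fanPair (finVar k (2 * m + 1 + 1)) (m + 1)).1 =
      Polynomial.C (Polynomial.C (fanPair (finVar k (2 * m)) m).1 * Polynomial.X +
        Polynomial.C (fanPair (finVar k (2 * m)) m).2) := by
    rw [fanPair, map_add, map_mul, he₀, h₁, h₂, ← Polynomial.C_mul, Polynomial.X_mul,
      ← Polynomial.C_add]
  refine ⟨e, h, ?_⟩
  rw [fanPair] at h ⊢
  rw [map_add, map_mul, map_mul, h, he₀, he₁, h₂, Polynomial.X_mul, Polynomial.C_mul]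

/-- The first entry is the previous fan polynomial; where it is invertible, the second entry is a
coordinate replacing the variable of the new path edge. -/
lemma openClass_fanPair_succ (m : ℕ) :
    openClass k ((fanPair (finVar k (2 * (m + 1))) (m + 1)).1 *
        (fanPair (finVar k (2 * (m + 1))) (m + 1)).2) =
      𝕋 k * openClass k (fanPolynomial (finVar k (2 * m + 1)) m) := by
  obtain ⟨e, h₁, h₂⟩ := exists_equiv_fanPair_succ (k := k) (show 2 * (m + 1) = 2 * m + 1 + 1 by lia)
  rw [openClass_congr (B := Polynomial (Polynomial (MvPolynomial (Fin (2 * m)) k))) e, map_mul,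
    h₁, h₂, openClass_C_mul_linear, openClass_fanPolynomial]

lemma openClass_fanPolynomial_succ (m : ℕ) :
    openClass k (fanPolynomial (finVar k (2 * (m + 1) + 1)) (m + 1)) =
      𝕋 k * (𝕋 k + 1) * openClass k (fanPolynomial (finVar k (2 * m + 1)) m) +
        (𝕋 k + 1) ^ 2 * openClass k ((fanPair (finVar k (2 * m)) m).1 *
          (fanPair (finVar k (2 * m)) m).2) := by
  obtain ⟨e, h₁, h₂⟩ := exists_equiv_fanPair_succ (k := k) (show 2 * (m + 1) = 2 * m + 1 + 1 by lia)
  rw [openClass_fanPolynomial, openClass_linear_congr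
    (B := Polynomial (Polynomial (MvPolynomial (Fin (2 * m)) k))) e, h₁, h₂, openClass_fan,
    openClass_fanPolynomial m]

lemma openClass_fanPolynomial_zero :
    openClass k (fanPolynomial (finVar k (2 * 0 + 1)) 0) = 𝕋 k + 1 := by
  simp only [fanPolynomial, fanPair, mul_zero, zero_add]
  rw [openClass_of_isUnit isUnit_one]
  exact affineClass_mvPolynomial_fin_one

lemma openClass_fanPolynomial_one :
    openClass k (fanPolynomial (finVar k (2 * 1 + 1)) 1) = 𝕋 k * (𝕋 k + 1) ^ 2 := by
  rw [openClass_fanPolynomial_succ 0, openClass_fanPolynomial_zero]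
  -- The last spoke of a single edge is a bridge: the first entry of the pair is `0`.
  simp only [fanPair, zero_mul, openClass_zero]
  ring

lemma openClass_fanPolynomial_add_two (m : ℕ) :
    openClass k (fanPolynomial (finVar k (2 * (m + 2) + 1)) (m + 2)) =
      𝕋 k * (𝕋 k + 1) * openClass k (fanPolynomial (finVar k (2 * (m + 1) + 1)) (m + 1)) +
        𝕋 k * (𝕋 k + 1) ^ 2 * openClass k (fanPolynomial (finVar k (2 * m + 1)) m) := by
  rw [openClass_fanPolynomial_succ (m + 1), openClass_fanPair_succ m]
  ring

end GrothendieckRing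

/-! ### Spanning trees of the fan, encoded as sets of edge numbers. -/

section FanTree

open Finset

/-- The edges of the `m`-th lemon graph that are listed in `D` (the spoke to the `i`-th vertex of
the path as `2 i`, the `i`-th edge of the path as `2 i + 1`) form a connected graph: a function on
the vertices that is constant along these edges is constant. -/
def IsFanConnected (m : ℕ) (D : Finset ℕ) : Prop :=
  ∀ g : ℕ → Prop, (∀ i ≤ m, 2 * i ∈ D → g i) → (∀ i < m, 2 * i + 1 ∈ D → (g i ↔ g (i + 1))) →
    ∀ i ≤ m, g i

/-- The edges of the `m`-th lemon graph that are listed in `D` form a spanning tree. -/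
def IsFanTree (m : ℕ) (D : Finset ℕ) : Prop :=
  #D = m + 1 ∧ IsFanConnected m D

variable {m : ℕ} {D : Finset ℕ}

/-- Both edges at the last vertex are missing, so the predicate that fails only there is a
counterexample. -/
lemma not_isFanConnected_succ (hD : D ⊆ range (2 * m + 1)) : ¬ IsFanConnected (m + 1) D := by
  intro h
  refine h (fun i => i ≠ m + 1) (fun i hi hD' => ?_) (fun i hi hD' => ?_) (m + 1) le_rfl rfl
  · have := mem_range.1 (hD hD')
    lia
  · have := mem_range.1 (hD hD')
    lia

lemma isFanConnected_insert_path (hD : D ⊆ range (2 * m + 1)) :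
    IsFanConnected (m + 1) (insert (2 * m + 1) D) ↔ IsFanConnected m D := by
  constructor
  · intro h g h₁ h₂ i hi
    -- The new vertex is a leaf at the end of the old path, so it takes the value there.
    have := h (fun i => if i = m + 1 then g m else g i) (fun j hj hj' => ?_) (fun j hj hj' => ?_)
      i (by lia)
    · simpa [show i ≠ m + 1 by lia] using this
    · have hj' : 2 * j ∈ D := by
        rcases mem_insert.1 hj' with h | h
        · lia
        · exact h
      have := mem_range.1 (hD hj')
      simpa [show j ≠ m + 1 by lia] using h₁ j (by lia) hj'
    · rcases mem_insert.1 hj' with h | h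
      · obtain rfl : j = m := by lia
        simp
      · have := mem_range.1 (hD h)
        simpa [show j ≠ m + 1 by lia, show j ≠ m by lia] using h₂ j (by lia) h
  · intro h g h₁ h₂ i hi
    have h' := h g (fun j hj hj' => h₁ j (by lia) (mem_insert_of_mem hj'))
      (fun j hj hj' => h₂ j (by lia) (mem_insert_of_mem hj'))
    rcases Nat.le_succ_iff.1 hi with hi | rfl
    · exact h' i hi
    · exact (h₂ m (by lia) (mem_insert_self _ _)).1 (h' m le_rfl)

lemma isFanConnected_insert_spoke (hD : D ⊆ range (2 * m + 1)) :
    IsFanConnected (m + 1) (insert (2 * m + 2) D) ↔ IsFanConnected m D := by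
  constructor
  · intro h g h₁ h₂ i hi
    -- The new vertex is a leaf at the apex, where the implicit value is `True`.
    have := h (fun i => i = m + 1 ∨ g i) (fun j hj hj' => ?_) (fun j hj hj' => ?_)
      i (by lia)
    · simpa [show i ≠ m + 1 by lia] using this
    · rcases mem_insert.1 hj' with h | h
      · exact .inl (by lia)
      · have := mem_range.1 (hD h)
        exact .inr (h₁ j (by lia) h)
    · have hj' : 2 * j + 1 ∈ D := by
        rcases mem_insert.1 hj' with h | h
        · lia
        · exact h
      have := mem_range.1 (hD hj')
      simpa [show j ≠ m + 1 by lia, show j ≠ m by lia] using h₂ j (by lia) hj'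
  · intro h g h₁ h₂ i hi
    have h' := h g (fun j hj hj' => h₁ j (by lia) (mem_insert_of_mem hj'))
      (fun j hj hj' => h₂ j (by lia) (mem_insert_of_mem hj'))
    rcases Nat.le_succ_iff.1 hi with hi | rfl
    · exact h' i hi
    · exact h₁ (m + 1) le_rfl (mem_insert_self _ _)

/-- The two new edges join the apex to vertex `m` through the new vertex, just as the spoke `2 * m`
does directly. -/
lemma isFanConnected_insert_insert (hD : D ⊆ range (2 * m + 1)) :
    IsFanConnected (m + 1) (insert (2 * m + 2) (insert (2 * m + 1) D)) ↔
      IsFanConnected m (insert (2 * m) D) := by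
  constructor
  · intro h g h₁ h₂ i hi
    have := h (fun i => i = m + 1 ∨ g i) (fun j hj hj' => ?_) (fun j hj hj' => ?_)
      i (by lia)
    · simpa [show i ≠ m + 1 by lia] using this
    · simp only [mem_insert] at hj'
      rcases hj' with h | h | h
      · exact .inl (by lia)
      · lia
      · have := mem_range.1 (hD h)
        exact .inr (h₁ j (by lia) (mem_insert_of_mem h))
    · simp only [mem_insert] at hj'
      rcases hj' with h | h | h
      · lia
      · obtain rfl : j = m := by lia
        simpa using h₁ j le_rfl (mem_insert_self _ _)
      · have := mem_range.1 (hD h)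
        simpa [show j ≠ m + 1 by lia, show j ≠ m by lia] using
          h₂ j (by lia) (mem_insert_of_mem h)
  · intro h g h₁ h₂ i hi
    have hl : g (m + 1) := h₁ (m + 1) le_rfl (mem_insert_self _ _)
    have hm : g m := (h₂ m (by lia) (by simp)).2 hl
    have h' := h g (fun j hj hj' => ?_) (fun j hj hj' => ?_)
    · rcases Nat.le_succ_iff.1 hi with hi | rfl
      · exact h' i hi
      · exact hl
    · rcases mem_insert.1 hj' with h | h
      · obtain rfl : j = m := by lia
        exact hm
      · exact h₁ j (by lia) (by simp [h])
    · rcases mem_insert.1 hj' with h | h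
      · lia
      · exact h₂ j (by lia) (by simp [h])

lemma exists_subset_range_of_subset_range_succ {n : ℕ} (hD : D ⊆ range (n + 1)) :
    ∃ E ⊆ range n, D = E ∨ D = insert n E := by
  rw [range_add_one, subset_insert_iff] at hD
  by_cases h : n ∈ D
  · exact ⟨_, hD, .inr (insert_erase h).symm⟩
  · exact ⟨_, hD, .inl (erase_eq_of_notMem h).symm⟩

/-- Removing the last vertex costs at least one edge in each case. The bound serves to exclude
cycles by counting. -/
lemma IsFanConnected.lt_card (hD : D ⊆ range (2 * m + 1)) (h : IsFanConnected m D) :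
    m < #D := by
  induction m generalizing D with
  | zero =>
    by_contra hc
    obtain rfl : D = ∅ := by simpa using hc
    exact h (fun _ => False) (by simp) (by simp) 0 le_rfl
  | succ m ih =>
    obtain ⟨E, hE, h'⟩ := exists_subset_range_of_subset_range_succ hD
    obtain ⟨F, hF, h''⟩ := exists_subset_range_of_subset_range_succ hE
    have h₁ : 2 * m + 1 ∉ F := fun h => by simpa using hF h
    have h₂ : 2 * m + 2 ∉ F := fun h => by simpa using hF h
    rcases h' with rfl | rfl <;> rcases h'' with rfl | rfl
    · exact (not_isFanConnected_succ hF h).elim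
    · have := ih hF ((isFanConnected_insert_path hF).1 h)
      simpa [h₁] using this
    · have := ih hF ((isFanConnected_insert_spoke hF).1 h)
      simpa [Nat.mul_add, h₂] using this
    · have := ih (insert_subset (by simp) hF) ((isFanConnected_insert_insert hF).1 h)
      have h₃ := card_insert_le (2 * m) F
      have : 2 * m + 2 ∉ insert (2 * m + 1) F := by simp [h₂]
      change _ < #(insert (2 * m + 2) (insert (2 * m + 1) F))
      rw [card_insert_of_notMem this, card_insert_of_notMem h₁]
      lia

lemma isFanTree_insert_path (hD : D ⊆ range (2 * m + 1)) :
    IsFanTree (m + 1) (insert (2 * m + 1) D) ↔ IsFanTree m D := by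
  have h₁ : 2 * m + 1 ∉ D := fun h => by simpa using hD h
  rw [IsFanTree, IsFanTree, isFanConnected_insert_path hD, card_insert_of_notMem h₁]
  simp

lemma isFanTree_insert_spoke (hD : D ⊆ range (2 * m + 1)) :
    IsFanTree (m + 1) (insert (2 * m + 2) D) ↔ IsFanTree m D := by
  have h₁ : 2 * m + 2 ∉ D := fun h => by simpa using hD h
  rw [IsFanTree, IsFanTree, isFanConnected_insert_spoke hD, card_insert_of_notMem h₁]
  simp

lemma isFanTree_insert_insert (hD : D ⊆ range (2 * m + 1)) :
    IsFanTree (m + 1) (insert (2 * m + 2) (insert (2 * m + 1) D)) ↔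
      2 * m ∉ D ∧ IsFanTree m (insert (2 * m) D) := by
  have h₁ : 2 * m + 1 ∉ D := fun h => by simpa using hD h
  have h₂ : 2 * m + 2 ∉ insert (2 * m + 1) D := fun h => by
    have := mem_range.1 (hD (by simpa using h))
    lia
  rw [IsFanTree, IsFanTree, isFanConnected_insert_insert hD, card_insert_of_notMem h₂,
    card_insert_of_notMem h₁]
  by_cases h : 2 * m ∈ D
  -- All three edges of the last triangle would be present; then `D` alone would be connected with
  -- only `m` edges.
  · simp only [h, not_true, false_and, iff_false, insert_eq_of_mem]
    rintro ⟨h₃, h₄⟩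
    have := h₄.lt_card hD
    lia
  · simp [h]

variable {S : Type*} [CommRing S] (x : ℕ → S)

open Classical in
-- Sort the trees by the last two edges: neither is impossible, exactly one gives a tree of the
-- smaller fan, and both give a tree of the smaller fan through its last spoke. The second sum, over
-- the trees through the last spoke, is what the last case needs from the induction.
lemma sum_isFanTree (m : ℕ) :
    (∑ D ∈ (range (2 * m + 1)).powerset with IsFanTree m D, ∏ i ∈ range (2 * m + 1) \ D, x i) =
        fanPolynomial x m ∧
      (∑ D ∈ (range (2 * m)).powerset with IsFanTree m (insert (2 * m) D),
        ∏ i ∈ range (2 * m) \ D, x i) = (fanPair x m).2 := by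
  simp only [sum_filter]
  have hw₁ (n : ℕ) (D) (hD : D ∈ (range n).powerset) :
      ∏ i ∈ range (n + 1) \ D, x i = x n * ∏ i ∈ range n \ D, x i := by
    have : n ∉ D := fun h => by simpa using mem_powerset.1 hD h
    rw [range_add_one, insert_sdiff_of_notMem _ this, prod_insert (by simp)]
  have hw₂ (n : ℕ) (D) (hD : D ∈ (range n).powerset) :
      ∏ i ∈ range (n + 1) \ insert n D, x i = ∏ i ∈ range n \ D, x i := by
    rw [range_add_one, insert_sdiff_insert, sdiff_insert_of_notMem (by simp)]
  have hs (n : ℕ) (f : Finset ℕ → S) : ∑ D ∈ (range (n + 1)).powerset, f D =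
      ∑ D ∈ (range n).powerset, f D + ∑ D ∈ (range n).powerset, f (insert n D) := by
    rw [range_add_one, sum_powerset_insert (by simp)]
  induction m with
  | zero =>
    have h₀ : ¬ IsFanTree 0 ∅ := by simp [IsFanTree]
    have h₁ : IsFanTree 0 {0} := by simp +contextual [IsFanTree, IsFanConnected]
    constructor
    · rw [mul_zero, hs 0]
      simp [fanPolynomial, fanPair, h₀, h₁]
    · rw [mul_zero, range_zero, powerset_empty, sum_singleton, insert_empty_eq, if_pos h₁]
      rfl
  | succ m ih =>
    obtain ⟨ih₁, ih₂⟩ := ih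
    have h₀ : ∑ D ∈ (range (2 * m + 1)).powerset,
        (if IsFanTree (m + 1) D then ∏ i ∈ range (2 * m + 1 + 1 + 1) \ D, x i else 0) = 0 :=
      sum_eq_zero fun D hD => if_neg fun h => not_isFanConnected_succ (mem_powerset.1 hD) h.2
    have h₁ : ∑ D ∈ (range (2 * m + 1)).powerset,
        (if IsFanTree (m + 1) (insert (2 * m + 1) D) then
          ∏ i ∈ range (2 * m + 1 + 1 + 1) \ insert (2 * m + 1) D, x i else 0) =
        x (2 * m + 2) * fanPolynomial x m := by
      rw [← ih₁, mul_sum]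
      refine sum_congr rfl fun D hD => ?_
      have hD' : insert (2 * m + 1) D ∈ (range (2 * m + 1 + 1)).powerset := by
        rw [range_add_one, mem_powerset]
        exact insert_subset_insert _ (mem_powerset.1 hD)
      simp only [isFanTree_insert_path (mem_powerset.1 hD), hw₁ _ _ hD', hw₂ _ _ hD, mul_ite,
        mul_zero]
    have h₂ : ∑ D ∈ (range (2 * m + 1)).powerset,
        (if IsFanTree (m + 1) (insert (2 * m + 2) D) then
          ∏ i ∈ range (2 * m + 1 + 1) \ D, x i else 0) =
        x (2 * m + 1) * fanPolynomial x m := by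
      rw [← ih₁, mul_sum]
      refine sum_congr rfl fun D hD => ?_
      simp only [isFanTree_insert_spoke (mem_powerset.1 hD), hw₁ _ _ hD, mul_ite, mul_zero]
    have h₃ : ∑ D ∈ (range (2 * m + 1)).powerset,
        (if IsFanTree (m + 1) (insert (2 * m + 2) (insert (2 * m + 1) D)) then
          ∏ i ∈ range (2 * m + 1 + 1) \ insert (2 * m + 1) D, x i else 0) =
        x (2 * m) * (fanPair x m).2 := by
      rw [← ih₂, mul_sum]
      -- Split by whether `2 * m ∈ D`: the sets containing it contribute nothing, the others acquire
      -- the factor `x (2 * m)`.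
      refine (sum_congr rfl fun D hD => ?_).trans ((hs _ fun D =>
        if 2 * m ∉ D ∧ IsFanTree m (insert (2 * m) D) then ∏ i ∈ range (2 * m + 1) \ D, x i
        else 0).trans ?_)
      · simp only [isFanTree_insert_insert (mem_powerset.1 hD), hw₂ _ _ hD]
      · simp only [mem_insert_self, not_true, false_and, if_false, sum_const_zero, add_zero]
        refine sum_congr rfl fun D hD => ?_
        have : 2 * m ∉ D := fun h => by simpa using mem_powerset.1 hD h
        simp only [this, not_false_eq_true, true_and, hw₁ _ _ hD, mul_ite, mul_zero]
    have hm : 2 * (m + 1) = 2 * m + 1 + 1 := by ring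
    -- The cases through the last spoke again, now weighted over all edges: a spoke in the tree adds
    -- no factor.
    have h₂' : ∑ D ∈ (range (2 * m + 1)).powerset,
        (if IsFanTree (m + 1) (insert (2 * m + 1 + 1) D) then
          ∏ i ∈ range (2 * m + 1 + 1 + 1) \ insert (2 * m + 1 + 1) D, x i else 0) =
        x (2 * m + 1) * fanPolynomial x m := by
      rw [← h₂]
      refine sum_congr rfl fun D hD => ?_
      rw [hw₂]
      exact powerset_mono.2 (range_subset_range.2 (by lia)) hD
    have h₃' : ∑ D ∈ (range (2 * m + 1)).powerset,
        (if IsFanTree (m + 1) (insert (2 * m + 1 + 1) (insert (2 * m + 1) D)) then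
          ∏ i ∈ range (2 * m + 1 + 1 + 1) \ insert (2 * m + 1 + 1) (insert (2 * m + 1) D), x i
          else 0) = x (2 * m) * (fanPair x m).2 := by
      rw [← h₃]
      refine sum_congr rfl fun D hD => ?_
      rw [hw₂]
      rw [range_add_one, mem_powerset]
      exact insert_subset_insert _ (mem_powerset.1 hD)
    constructor
    · rw [hm, hs (2 * m + 1 + 1), hs (2 * m + 1), hs (2 * m + 1), h₀, h₁, h₂', h₃']
      simp only [fanPolynomial, fanPair, hm]
      ring
    · rw [hm, hs (2 * m + 1), h₂, h₃, fanPair, fanPolynomial]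

end FanTree

/-! ### The lemon graph, its edge numbering and its Kirchhoff polynomial. -/

section LemonGraph

open Finset

/-- The vertices of the path in the `m`-th lemon graph. -/
def lemonVertex (m i : ℕ) : Option (Fin (m + 1)) :=
  some (Fin.ofNat (m + 1) i)

/-- The edges of the `m`-th lemon graph: the spokes as `2 i`, the edges of the path as
`2 i + 1`. -/
def lemonEdge (m i : ℕ) : Sym2 (Option (Fin (m + 1))) :=
  if Even i then s(none, lemonVertex m (i / 2))
  else s(lemonVertex m (i / 2), lemonVertex m (i / 2 + 1))

variable {m : ℕ}

lemma lemonEdge_two_mul (i : ℕ) : lemonEdge m (2 * i) = s(none, lemonVertex m i) := by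
  simp [lemonEdge]

lemma lemonEdge_two_mul_add_one (i : ℕ) :
    lemonEdge m (2 * i + 1) = s(lemonVertex m i, lemonVertex m (i + 1)) := by
  simp [lemonEdge, show (2 * i + 1) / 2 = i by lia]

/-- The bounds matter because `Fin.ofNat` reduces modulo `m + 1`. -/
lemma lemonVertex_inj {i j : ℕ} (hi : i ≤ m) (hj : j ≤ m) :
    lemonVertex m i = lemonVertex m j ↔ i = j := by
  simp [lemonVertex, Fin.ext_iff, Fin.ofNat, Nat.mod_eq_of_lt (Nat.lt_succ_of_le hi),
    Nat.mod_eq_of_lt (Nat.lt_succ_of_le hj)]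

lemma lemonVertex_val (i : Fin (m + 1)) : lemonVertex m i = some i := by
  simp [lemonVertex]

lemma lemonEdge_injOn : Set.InjOn (lemonEdge m) (Set.Iio (2 * m + 1)) := by
  intro i hi j hj h
  simp only [Set.mem_Iio] at hi hj
  obtain ⟨a, rfl | rfl⟩ := Nat.even_or_odd' i <;> obtain ⟨b, rfl | rfl⟩ := Nat.even_or_odd' j
  · rw [lemonEdge_two_mul, lemonEdge_two_mul, Sym2.congr_right,
      lemonVertex_inj (by lia) (by lia)] at h
    rw [h]
  · rw [lemonEdge_two_mul, lemonEdge_two_mul_add_one] at h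
    simp [lemonVertex] at h
  · rw [lemonEdge_two_mul, lemonEdge_two_mul_add_one] at h
    simp [lemonVertex] at h
  · rw [lemonEdge_two_mul_add_one, lemonEdge_two_mul_add_one, Sym2.eq_iff,
      lemonVertex_inj (by lia) (by lia), lemonVertex_inj (by lia) (by lia),
      lemonVertex_inj (by lia) (by lia), lemonVertex_inj (by lia) (by lia)] at h
    lia

lemma lemonEdge_image : lemonEdge m '' Set.Iio (2 * m + 1) = (lemonGraph m).edgeSet := by
  ext e
  constructor
  · rintro ⟨i, hi, rfl⟩
    simp only [Set.mem_Iio] at hi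
    obtain ⟨a, rfl | rfl⟩ := Nat.even_or_odd' i
    · rw [lemonEdge_two_mul]
      trivial
    · rw [lemonEdge_two_mul_add_one]
      refine SimpleGraph.pathGraph_adj.2 (.inl ?_)
      simp [Fin.ofNat, Nat.mod_eq_of_lt (show a < m + 1 by lia),
        Nat.mod_eq_of_lt (show a + 1 < m + 1 by lia)]
  · have hp (i j : Fin (m + 1)) (h : (i : ℕ) + 1 = j) :
        s(some i, some j) ∈ lemonEdge m '' Set.Iio (2 * m + 1) := by
      refine ⟨2 * i + 1, ?_, ?_⟩
      · simp only [Set.mem_Iio]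
        lia
      · rw [lemonEdge_two_mul_add_one, h, lemonVertex_val, lemonVertex_val]
    have hs (i : Fin (m + 1)) : s(none, some i) ∈ lemonEdge m '' Set.Iio (2 * m + 1) := by
      refine ⟨2 * i, ?_, ?_⟩
      · simp only [Set.mem_Iio]
        lia
      · rw [lemonEdge_two_mul, lemonVertex_val]
    induction e with
    | h u v =>
      intro h
      rcases u with _ | i <;> rcases v with _ | j
      · exact h.elim
      · exact hs j
      · rw [Sym2.eq_swap]
        exact hs i
      · rcases SimpleGraph.pathGraph_adj.1 h with h | h
        · exact hp i j h
        · rw [Sym2.eq_swap]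
          exact hp j i h

lemma lemonGraph_connected (m : ℕ) : (lemonGraph m).Connected := by
  have hr (v : Option (Fin (m + 1))) : (lemonGraph m).Reachable none v := by
    rcases v with _ | i
    · exact .refl _
    · exact SimpleGraph.Adj.reachable (G := lemonGraph m) trivial
  exact ⟨fun u v => (hr u).symm.trans (hr v)⟩

lemma connected_iff_isFanConnected {T : SimpleGraph (Option (Fin (m + 1)))} {D : Finset ℕ}
    (hT : T.edgeSet = lemonEdge m '' D) (hD : D ⊆ range (2 * m + 1)) :
    T.Connected ↔ IsFanConnected m D := by
  constructor
  · intro h g h₁ h₂ i hi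
    let f : Option (Fin (m + 1)) → Prop := fun v => v.elim True fun i => g i
    have hv {i : ℕ} (hi : i ≤ m) : f (lemonVertex m i) ↔ g i := by
      simp [f, lemonVertex, Fin.ofNat, Nat.mod_eq_of_lt (Nat.lt_succ_of_le hi)]
    have hf {u v} (huv : T.Adj u v) : f u ↔ f v := by
      rw [← SimpleGraph.mem_edgeSet, hT] at huv
      obtain ⟨j, hj, hj'⟩ := huv
      have hj'' := mem_range.1 (hD hj)
      obtain ⟨a, rfl | rfl⟩ := Nat.even_or_odd' j
      · rw [lemonEdge_two_mul, Sym2.eq_iff] at hj'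
        have := (hv (show a ≤ m by lia)).2 (h₁ a (by lia) hj)
        rcases hj' with ⟨rfl, rfl⟩ | ⟨rfl, rfl⟩ <;> simpa [f] using this
      · rw [lemonEdge_two_mul_add_one, Sym2.eq_iff] at hj'
        have := h₂ a (by lia) hj
        rw [← hv (by lia), ← hv (by lia)] at this
        rcases hj' with ⟨rfl, rfl⟩ | ⟨rfl, rfl⟩
        · exact this
        · exact this.symm
    have hw {u v} (p : T.Walk u v) : f u ↔ f v := by
      induction p with
      | nil => rfl
      | cons h _ ih => exact (hf h).trans ih
    obtain ⟨p⟩ := h.preconnected none (lemonVertex m i)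
    exact (hv hi).1 ((hw p).1 trivial)
  · intro h
    have hadj {j : ℕ} (hj : j ∈ D) {u v} (huv : lemonEdge m j = s(u, v)) : T.Adj u v := by
      rw [← SimpleGraph.mem_edgeSet, hT, ← huv]
      exact ⟨j, hj, rfl⟩
    -- Reachability from the apex is the test predicate.
    have h' := h (fun i => T.Reachable none (lemonVertex m i))
      (fun i _ hi => (hadj hi (lemonEdge_two_mul i)).reachable)
      (fun i _ hi => by
        have := (hadj hi (lemonEdge_two_mul_add_one i)).reachable
        exact ⟨fun h => h.trans this, fun h => h.trans this.symm⟩)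
    have hr (v : Option (Fin (m + 1))) : T.Reachable none v := by
      rcases v with _ | i
      · exact .refl _
      · rw [← lemonVertex_val]
        exact h' i (by lia)
    exact ⟨fun u v => (hr u).symm.trans (hr v)⟩

/-- In a connected graph the maximal acyclic subgraphs are the spanning trees, and a tree is a
connected graph with one edge fewer than its `m + 2` vertices. -/
lemma isSpanningForest_iff_isFanTree {T : SimpleGraph (Option (Fin (m + 1)))} {D : Finset ℕ}
    (hT : T.edgeSet = lemonEdge m '' D) (hD : D ⊆ range (2 * m + 1)) :
    (lemonGraph m).IsSpanningForest T ↔ IsFanTree m D := by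
  have hinj : Set.InjOn (lemonEdge m) D := lemonEdge_injOn.mono fun i hi => by
    simpa using hD hi
  have hle : T ≤ lemonGraph m := by
    rw [← SimpleGraph.edgeSet_subset_edgeSet, hT, ← lemonEdge_image]
    exact Set.image_mono fun i hi => by simpa using hD hi
  rw [SimpleGraph.IsSpanningForest,
    (lemonGraph_connected m).maximal_le_isAcyclic_iff_isTree hle,
    SimpleGraph.isTree_iff_connected_and_card, connected_iff_isFanConnected hT hD, IsFanTree,
    and_comm, hT, Nat.card_image_of_injOn hinj]
  simp

/-- The numbering of the edges of the lemon graph. -/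
noncomputable def lemonEdgeEquiv (m : ℕ) : Fin (2 * m + 1) ≃ (lemonGraph m).edgeSet :=
  .ofBijective (fun i => ⟨lemonEdge m i, lemonEdge_image.subset ⟨i, i.2, rfl⟩⟩)
    ⟨fun i j h => Fin.ext (lemonEdge_injOn i.2 j.2 (congrArg Subtype.val h)), fun e => by
      obtain ⟨i, hi, h⟩ := lemonEdge_image.superset e.2
      exact ⟨⟨i, hi⟩, Subtype.ext h⟩⟩

open MvPolynomial

open Classical in
-- The index set becomes an opaque finset known only by membership, so the instances in its
-- definition no longer matter.
lemma exists_kirchhoffPolynomial_eq_sum (k : Type u) [Field k] {V : Type} [Fintype V]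
    (G : SimpleGraph V) :
    ∃ s : Finset (SimpleGraph V), (∀ T, T ∈ s ↔ G.IsSpanningForest T) ∧
      G.kirchhoffPolynomial k =
        ∑ T ∈ s, ∏ e ∈ univ.filter fun e : G.edgeSet => e.1 ∉ T.edgeSet, X e :=
  ⟨_, by simp, rfl⟩

lemma rename_kirchhoffPolynomial_lemonGraph (k : Type u) [Field k] (m : ℕ) :
    rename (lemonEdgeEquiv m).symm ((lemonGraph m).kirchhoffPolynomial k) =
      fanPolynomial (finVar k (2 * m + 1)) m := by
  classical
  obtain ⟨s, hs, h⟩ := exists_kirchhoffPolynomial_eq_sum k (lemonGraph m)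
  rw [← (sum_isFanTree (finVar k (2 * m + 1)) m).1, h, map_sum]
  obtain ⟨F, hF⟩ : ∃ F : SimpleGraph (Option (Fin (m + 1))) → Finset ℕ,
      ∀ T i, i ∈ F T ↔ i ∈ range (2 * m + 1) ∧ lemonEdge m i ∈ T.edgeSet :=
    ⟨fun T => {i ∈ range (2 * m + 1) | lemonEdge m i ∈ T.edgeSet}, fun _ _ => mem_filter⟩
  have hsub (T) : F T ⊆ range (2 * m + 1) := fun i hi => ((hF T i).1 hi).1
  have hD (T : SimpleGraph (Option (Fin (m + 1)))) (hT : T ≤ lemonGraph m) :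
      T.edgeSet = lemonEdge m '' F T := by
    ext e
    constructor
    · intro he
      obtain ⟨i, hi, rfl⟩ := lemonEdge_image.superset (SimpleGraph.edgeSet_mono hT he)
      exact ⟨i, (hF T i).2 ⟨mem_range.2 hi, he⟩, rfl⟩
    · rintro ⟨i, hi, rfl⟩
      exact ((hF T i).1 hi).2
  have hT (D : Finset ℕ) (hD : D ⊆ range (2 * m + 1)) :
      (SimpleGraph.fromEdgeSet (lemonEdge m '' D)).edgeSet = lemonEdge m '' D := by
    rw [SimpleGraph.edgeSet_fromEdgeSet, sdiff_eq_left, Set.disjoint_left]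
    rintro _ ⟨i, hi, rfl⟩
    exact SimpleGraph.not_isDiag_of_mem_edgeSet _
      (lemonEdge_image.subset ⟨i, by simpa using hD hi, rfl⟩)
  -- A spanning forest corresponds to the set of the numbers of its edges.
  refine sum_bij' (fun T _ => F T) (fun D _ => .fromEdgeSet (lemonEdge m '' D)) ?_ ?_ ?_ ?_ ?_
  · intro T h
    have h := (hs T).1 h
    exact mem_filter.2 ⟨mem_powerset.2 (hsub T),
      (isSpanningForest_iff_isFanTree (hD T h.prop.1) (hsub T)).1 h⟩
  · intro D h
    obtain ⟨h, h'⟩ := mem_filter.1 h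
    rw [mem_powerset] at h
    exact (hs _).2 ((isSpanningForest_iff_isFanTree (hT D h) h).2 h')
  · intro T h
    have h := (hs T).1 h
    rw [← hD T h.prop.1, SimpleGraph.fromEdgeSet_edgeSet]
  · intro D h
    have h := mem_powerset.1 (mem_filter.1 h).1
    ext i
    rw [hF, hT D h]
    refine ⟨fun ⟨hi, j, hj, hij⟩ => ?_, fun hi => ⟨h hi, i, hi, rfl⟩⟩
    rwa [← lemonEdge_injOn (by simpa using h hj) (by simpa using hi) hij]
  · intro T h
    rw [map_prod]
    have he' (e : (lemonGraph m).edgeSet) : lemonEdge m ((lemonEdgeEquiv m).symm e) = e :=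
      congrArg Subtype.val ((lemonEdgeEquiv m).apply_symm_apply e)
    refine prod_bij (fun e _ => ((lemonEdgeEquiv m).symm e : ℕ)) ?_ ?_ ?_ ?_
    · intro e he
      have hi : (((lemonEdgeEquiv m).symm e : ℕ)) < 2 * m + 1 := ((lemonEdgeEquiv m).symm e).2
      simp only [mem_filter, mem_univ, true_and] at he
      simp only [mem_sdiff, mem_range, hF, he', hi, he, and_false, not_false_eq_true,
        and_self]
    · intro e _ e' _ h
      exact (lemonEdgeEquiv m).symm.injective (Fin.ext h)
    · intro i hi
      simp only [mem_sdiff, mem_range, hF, not_and] at hi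
      exact ⟨lemonEdgeEquiv m ⟨i, hi.1⟩, mem_filter.2 ⟨mem_univ _, hi.2 hi.1⟩, by simp⟩
    · intro e _
      rw [rename_X, finVar, dif_pos ((lemonEdgeEquiv m).symm e).2]

end LemonGraph

/-! ### From hypersurface complements to the generating function. -/

namespace GrothendieckRing

lemma mk_hypersurfaceComplement {k : Type u} [Field k] {σ : Type} [Finite σ]
    (f : MvPolynomial σ k) : mk (.hypersurfaceComplement f) = openClass k f := by
  refine mk_eq_of_iso (X := .hypersurfaceComplement f) (Y := .spec k (Localization.Away f))
    (basicOpenIsoSpecAway (R := .of (MvPolynomial σ k)) f) ?_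
  have : Spec.map (CommRingCat.ofHom (algebraMap k (Localization.Away f))) =
      Spec.map (CommRingCat.ofHom (algebraMap (MvPolynomial σ k) (Localization.Away f))) ≫
        Spec.map (CommRingCat.ofHom (algebraMap k (MvPolynomial σ k))) := by
    rw [← Spec.map_comp, ← CommRingCat.ofHom_comp, ← IsScalarTower.algebraMap_eq]
  simp only [Variety.spec, Variety.hypersurfaceComplement, Variety.openSubvariety]
  rw [this, ← Category.assoc]
  congr 1
  exact basicOpenIsoSpecAway_hom_SpecMap (R := .of (MvPolynomial σ k)) f

lemma motivicClass_lemonGraph (k : Type u) [Field k] (m : ℕ) :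
    𝕌 k (lemonGraph m) = openClass k (fanPolynomial (MvPolynomial.finVar k (2 * m + 1)) m) := by
  rw [SimpleGraph.motivicClass, mk_hypersurfaceComplement,
    openClass_congr (B := MvPolynomial (Fin (2 * m + 1)) k)
      (MvPolynomial.renameEquiv k (lemonEdgeEquiv m).symm),
    ← rename_kirchhoffPolynomial_lemonGraph]
  rfl

end GrothendieckRing

lemma PowerSeries.isUnit_of_constantCoeff_eq_one {R : Type*} [CommRing R] {f : PowerSeries R}
    (h : PowerSeries.constantCoeff f = 1) : IsUnit f :=
  PowerSeries.isUnit_iff_constantCoeff.2 (h ▸ isUnit_one)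

/-- The generating function of a sequence with a linear recursion of order two. -/
lemma PowerSeries.mk_mul_eq_C_of_recursion {R : Type*} [CommRing R] {u : ℕ → R} {a b : R}
    (h₁ : u 1 = a * u 0) (h : ∀ m, u (m + 2) = a * u (m + 1) + b * u m) :
    PowerSeries.mk u * (1 - PowerSeries.C a * PowerSeries.X -
      PowerSeries.C b * PowerSeries.X ^ 2) = PowerSeries.C (u 0) := by
  have : PowerSeries.mk u * (1 - PowerSeries.C a * PowerSeries.X -
      PowerSeries.C b * PowerSeries.X ^ 2) = PowerSeries.mk u -
        PowerSeries.C a * (PowerSeries.mk u * PowerSeries.X) -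
        PowerSeries.C b * (PowerSeries.mk u * PowerSeries.X ^ 2) := by ring
  rw [this]
  ext n
  simp only [map_sub, PowerSeries.coeff_C_mul, PowerSeries.coeff_mk, PowerSeries.coeff_C,
    PowerSeries.coeff_mul_X_pow']
  rcases n with _ | _ | n
  · simp
  -- The linear coefficient is `u 1 - a * u 0`; its vanishing makes the numerator constant.
  · rw [PowerSeries.coeff_succ_mul_X]
    simp [h₁]
  · rw [PowerSeries.coeff_succ_mul_X]
    simp [h]

theorem theorem5p9 (k : Type u) [Field k] :
    -- the generating function is `(𝕋 + 1) / (1 - 𝕋 (𝕋 + 1) s - 𝕋 (𝕋 + 1) ^ 2 s ^ 2)`: the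
    -- denominator is a unit of the ring of power series, and the product is the numerator
    (IsUnit (1 - PowerSeries.C (𝕋 k * (𝕋 k + 1)) * PowerSeries.X
        - PowerSeries.C (𝕋 k * (𝕋 k + 1) ^ 2) * PowerSeries.X ^ 2) ∧
      PowerSeries.mk (fun m => 𝕌 k (lemonGraph m)) *
        (1 - PowerSeries.C (𝕋 k * (𝕋 k + 1)) * PowerSeries.X
          - PowerSeries.C (𝕋 k * (𝕋 k + 1) ^ 2) * PowerSeries.X ^ 2) =
        PowerSeries.C (𝕋 k + 1)) ∧
    -- the recursion, with its initial values
    (𝕌 k (lemonGraph 0) = 𝕋 k + 1 ∧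
      𝕌 k (lemonGraph 1) = 𝕋 k * (𝕋 k + 1) ^ 2 ∧
      ∀ m : ℕ, 𝕌 k (lemonGraph (m + 2)) =
        𝕋 k * (𝕋 k + 1) * 𝕌 k (lemonGraph (m + 1)) +
          𝕋 k * (𝕋 k + 1) ^ 2 * 𝕌 k (lemonGraph m)) := by

  have h₀ : 𝕌 k (lemonGraph 0) = 𝕋 k + 1 := by
    rw [GrothendieckRing.motivicClass_lemonGraph, GrothendieckRing.openClass_fanPolynomial_zero]
  have h₁ : 𝕌 k (lemonGraph 1) = 𝕋 k * (𝕋 k + 1) ^ 2 := by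
    rw [GrothendieckRing.motivicClass_lemonGraph, GrothendieckRing.openClass_fanPolynomial_one]
  have h (m : ℕ) : 𝕌 k (lemonGraph (m + 2)) =
      𝕋 k * (𝕋 k + 1) * 𝕌 k (lemonGraph (m + 1)) +
        𝕋 k * (𝕋 k + 1) ^ 2 * 𝕌 k (lemonGraph m) := by
    simp only [GrothendieckRing.motivicClass_lemonGraph]
    exact GrothendieckRing.openClass_fanPolynomial_add_two m
  refine ⟨⟨PowerSeries.isUnit_of_constantCoeff_eq_one (by simp), ?_⟩, h₀, h₁, h⟩
  exact (PowerSeries.mk_mul_eq_C_of_recursion (by rw [h₀, h₁]; ring) h).trans (by rw [h₀])
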